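/- Let $X$ and $N$ be independent real random variables on a probability space, with $\mathbb{E}[X^2]<\infty$ and $N\sim\mathcal N(0,1)$. For $t\in\mathbb{R}$ let $Y_t=tX+N$ be the output of the scalar Gaussian channel with scaling factor $t$, and let $I(X;Y_t)$ be the mutual information in nats, i.e. the Kullback–Leibler divergence of the joint law of $(X,Y_t)$ from the product of its marginal laws. For a differentiable $F:\mathbb{R}\to\mathbb{R}$ put $D_F(x,y)=F(x)-F(y)-F'(y)(x-y)$, and let $\mathrm{mmse}(X|Y)=\mathbb{E}\big[(X-\mathbb{E}[X|Y])^2\big]$. Then $I(X;Y_t)<\infty$ for every $t\in\mathbb{R}$, and for every $\phi\in\mathbb{R}$, with $F(x)=\phi x^2$ (which for $\phi>0$ is nonnegative, continuously differentiable and strictly convex, so that $D_F$ is a classical Bregman divergence), the random variables $D_F(X,\mathbb{E}[X|Y_\phi])$ and $(X-\mathbb{E}[X|Y_\phi])^2$ are integrable, the function $t\mapsto I(X;Y_t)$ is differentiable at $\phi$, and $$\frac{\partial}{\partial t}I(X;Y_t)\Big|_{t=\phi}=\mathbb{E}\big[D_F(X,\mathbb{E}[X|Y_\phi])\big].$$ Moreover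 $\mathbb{E}\big[D_F(X,\mathbb{E}[X|Y_\phi])\big]=\phi\,\mathrm{mmse}(X|Y_\phi)$, so this is equivalent to $$\frac{\partial}{\partial t}I(X;Y_t)\Big|_{t=\phi}=\phi\,\mathrm{mmse}(X|Y_\phi),$$ which therefore also holds. -/

import Mathlib

open MeasureTheory ProbabilityTheory
open scoped ENNReal

/-- A generator of a classical Bregman divergence on the whole space: nonnegative, continuously
differentiable and strictly convex. -/
structure IsBregmanGenerator {E : Type*} [NormedAddCommGroup E] [InnerProductSpace ℝ E]
    (F : E → ℝ) : Prop where
  nonneg : ∀ x, 0 ≤ F x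
  contDiff : ContDiff ℝ 1 F
  strictConvexOn : StrictConvexOn ℝ Set.univ F

/-- The Bregman divergence `D_F(x, y) = F(x) - F(y) - ⟨∇F(y), x - y⟩`. The formula makes sense for
every differentiable `F`. -/
noncomputable def bregmanDiv {E : Type*} [NormedAddCommGroup E] [InnerProductSpace ℝ E]
    [CompleteSpace E] (F : E → ℝ) (x y : E) : ℝ :=
  F x - F y - inner ℝ (gradient F y) (x - y)

/-- The mutual information `I(X;Y)` in nats: the Kullback-Leibler divergence of the joint law of
`(X, Y)` from the product of the marginal laws, with values in `[0, ∞]`. -/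
noncomputable def mutualInfo {Ω α β : Type*} [MeasurableSpace Ω] [MeasurableSpace α]
    [MeasurableSpace β] (X : Ω → α) (Y : Ω → β) (P : Measure Ω) : ℝ≥0∞ :=
  InformationTheory.klDiv (P.map (fun ω => (X ω, Y ω))) ((P.map X).prod (P.map Y))

/-- The conditional mean `E[X|Y]`, as a random variable. -/
noncomputable def condMean {Ω β : Type*} [MeasurableSpace Ω] [mβ : MeasurableSpace β]
    (X : Ω → ℝ) (Y : Ω → β) (P : Measure Ω) : Ω → ℝ :=
  P[X | mβ.comap Y]

/-- The minimum mean-squared error `E[(X - E[X|Y])²]`. -/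
noncomputable def mmse {Ω β : Type*} [MeasurableSpace Ω] [MeasurableSpace β]
    (X : Ω → ℝ) (Y : Ω → β) (P : Measure Ω) : ℝ :=
  ∫ ω, (X ω - condMean X Y P ω) ^ 2 ∂P

/-- The output `Y = φ X + N` of the scalar channel with scaling factor `φ`, input `X` and additive
noise `N`. -/
def channelOutput {Ω : Type*} (X N : Ω → ℝ) (φ : ℝ) : Ω → ℝ :=
  fun ω => φ * X ω + N ω

/-! Take `N(0, 1)` as reference measure and write `g_t` for the density `gaussMarg` of the law of
`Y_t`. The joint law has density `gaussLik / g_t` against the product of the marginals, so `I(X;Y_t)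
= t²/2 · E[X²] - D(t)` with `D(t) = E[log g_t(Y_t)]` (`mutualInfo_channelOutput_eq`). Everything
reduces to differentiating `D` at `s`.

In `D` the parameter enters both the density and the point of evaluation. Freeze the density: `G(t)
= E[log g_s(Y_t)]`. Then `D(t) - G(t)` is the relative entropy of the law of `Y_t` from that of
`Y_s`. It is nonnegative and, by data processing, at most the relative entropy of the joint laws,
`(t - s)²/2 · E[X²]`. Hence `D - G` has derivative zero at `s`, and `g_t` is never differentiated in
`t`.

`G` is differentiated under the expectation, giving `E[X · gaussScore s (Y_s)]`; domination needs
only a score of linear growth, which follows from convexity of `log g_s`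
(`exists_gaussMarg_bounds`). By Tweedie's formula (`gaussScore_ae_eq_condExp`) the score at `Y_s` is
`s E[X|Y_s]`, so `D'(s) = s E[E[X|Y_s]²]`, and Pythagoras turns `s E[X²] - D'(s)` into `s · mmse`.
-/

/-- The density of `N(t x, 1)` with respect to `N(0, 1)`. -/
noncomputable def gaussLik (t x y : ℝ) : ℝ := Real.exp (t * x * y - (t * x) ^ 2 / 2)

/-- The density of the law of `t X + N` with respect to `N(0, 1)`, for `X ∼ μ`. -/
noncomputable def gaussMarg (μ : Measure ℝ) (t y : ℝ) : ℝ := ∫ x, gaussLik t x y ∂μ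

/-- The score `∂ log (gaussMarg μ t y) / ∂y`. -/
noncomputable def gaussScore (μ : Measure ℝ) (t y : ℝ) : ℝ :=
  (∫ x, t * x * gaussLik t x y ∂μ) / gaussMarg μ t y

/-! ### Gaussian likelihood -/

lemma gaussLik_pos (t x y : ℝ) : 0 < gaussLik t x y := Real.exp_pos _

/-- Completing the square. The bound is uniform in `x`, so no exponential moment of `X` is ever
needed. -/
lemma gaussLik_le (t x y : ℝ) : gaussLik t x y ≤ Real.exp (y ^ 2 / 2) :=
  Real.exp_le_exp.2 (by nlinarith [sq_nonneg (t * x - y)])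

lemma continuous_gaussLik (t : ℝ) : Continuous fun p : ℝ × ℝ => gaussLik t p.1 p.2 := by
  unfold gaussLik; fun_prop

lemma continuous_gaussLik_left (t y : ℝ) : Continuous fun x => gaussLik t x y := by
  unfold gaussLik; fun_prop

lemma hasDerivAt_gaussLik (t x y : ℝ) :
    HasDerivAt (fun y => gaussLik t x y) (t * x * gaussLik t x y) y := by
  unfold gaussLik
  have h : HasDerivAt (fun y => t * x * y - (t * x) ^ 2 / 2) (t * x) y := by
    simpa using ((hasDerivAt_id y).const_mul (t * x)).sub_const ((t * x) ^ 2 / 2)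
  simpa [mul_comm] using h.exp

/-! ### Output density: smoothness, log-convexity and growth -/

section Marginal

variable {μ : Measure ℝ} [IsProbabilityMeasure μ]

lemma integrable_gaussLik (t y : ℝ) : Integrable (fun x => gaussLik t x y) μ :=
  Integrable.of_bound (continuous_gaussLik_left t y).aestronglyMeasurable (Real.exp (y ^ 2 / 2))
    (.of_forall fun x => by
      rw [Real.norm_of_nonneg (gaussLik_pos t x y).le]; exact gaussLik_le t x y)

omit [IsProbabilityMeasure μ] in
lemma integrable_mul_gaussLik (hμ : Integrable id μ) (t y : ℝ) :
    Integrable (fun x => t * x * gaussLik t x y) μ :=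
  (hμ.const_mul t).mul_bdd (c := Real.exp (y ^ 2 / 2))
    (continuous_gaussLik_left t y).aestronglyMeasurable (.of_forall fun x => by
      rw [Real.norm_of_nonneg (gaussLik_pos t x y).le]; exact gaussLik_le t x y)

lemma gaussMarg_pos (t y : ℝ) : 0 < gaussMarg μ t y :=
  integral_exp_pos (integrable_gaussLik t y)

lemma gaussMarg_le (t y : ℝ) : gaussMarg μ t y ≤ Real.exp (y ^ 2 / 2) := by
  simpa [gaussMarg] using integral_mono (integrable_gaussLik (μ := μ) t y)
    (integrable_const (Real.exp (y ^ 2 / 2))) (fun x => gaussLik_le t x y)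

lemma hasDerivAt_gaussMarg (hμ : Integrable id μ) (t y : ℝ) :
    HasDerivAt (gaussMarg μ t) (∫ x, t * x * gaussLik t x y ∂μ) y := by
  refine (hasDerivAt_integral_of_dominated_loc_of_deriv_le
    (bound := fun x => |t * x| * Real.exp ((|y| + 1) ^ 2 / 2))
    (F' := fun y x => t * x * gaussLik t x y) (Metric.ball_mem_nhds y one_pos)
    (.of_forall fun z => (continuous_gaussLik_left t z).aestronglyMeasurable)
    (integrable_gaussLik t y) (integrable_mul_gaussLik hμ t y).1 (.of_forall fun x z hz => ?_)
    ((hμ.const_mul t).abs.mul_const _) (.of_forall fun x z _ => hasDerivAt_gaussLik t x z)).2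
  rw [norm_mul, Real.norm_eq_abs, Real.norm_of_nonneg (gaussLik_pos t x z).le]
  refine mul_le_mul_of_nonneg_left ((gaussLik_le t x z).trans (Real.exp_le_exp.2 ?_))
    (abs_nonneg _)
  have hz' : |z| ≤ |y| + 1 := by
    have h1 : |z - y| < 1 := by simpa [Real.dist_eq] using hz
    have h2 := abs_sub_abs_le_abs_sub z y
    linarith
  have := pow_le_pow_left₀ (abs_nonneg z) hz' 2
  rw [sq_abs] at this
  linarith

lemma hasDerivAt_log_gaussMarg (hμ : Integrable id μ) (t y : ℝ) :
    HasDerivAt (fun y => Real.log (gaussMarg μ t y)) (gaussScore μ t y) y :=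
  (hasDerivAt_gaussMarg hμ t y).log (gaussMarg_pos t y).ne'

lemma continuous_gaussMarg (hμ : Integrable id μ) (t : ℝ) : Continuous (gaussMarg μ t) :=
  continuous_iff_continuousAt.2 fun y => (hasDerivAt_gaussMarg hμ t y).continuousAt

lemma measurable_gaussScore (hμ : Integrable id μ) (t : ℝ) : Measurable (gaussScore μ t) := by
  have h : deriv (fun y => Real.log (gaussMarg μ t y)) = gaussScore μ t :=
    funext fun y => (hasDerivAt_log_gaussMarg hμ t y).deriv
  exact h ▸ measurable_deriv _

lemma gaussScore_mul_gaussMarg (t y : ℝ) :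
    gaussScore μ t y * gaussMarg μ t y = ∫ x, t * x * gaussLik t x y ∂μ :=
  div_mul_cancel₀ _ (gaussMarg_pos t y).ne'

/-- The logarithm of the marginal density lies above its tangents. -/
lemma gaussScore_mul_le (hμ : Integrable id μ) (t y z : ℝ) :
    gaussScore μ t y * (z - y) ≤
      Real.log (gaussMarg μ t z) - Real.log (gaussMarg μ t y) := by
  -- Jensen under the posterior weight proportional to `gaussLik t x y`: `b` is the posterior mean
  -- of `t x (z - y)`. The integrand below comes from the tangent of `exp` at `b`.
  set b := gaussScore μ t y * (z - y) with hb
  have hle : Real.exp b * gaussMarg μ t y ≤ gaussMarg μ t z := by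
    have hi : Integrable (fun x => Real.exp b * ((1 - b) * gaussLik t x y
        + (z - y) * (t * x * gaussLik t x y))) μ :=
      (((integrable_gaussLik t y).const_mul _).add
        ((integrable_mul_gaussLik hμ t y).const_mul _)).const_mul _
    have h := integral_mono hi (integrable_gaussLik (μ := μ) t z) (fun x => ?_)
    · rw [integral_const_mul, integral_add ((integrable_gaussLik t y).const_mul _)
        ((integrable_mul_gaussLik hμ t y).const_mul _), integral_const_mul,
        integral_const_mul, ← gaussScore_mul_gaussMarg t y] at h
      refine le_trans (le_of_eq ?_) h
      change _ = Real.exp b * ((1 - b) * gaussMarg μ t y + _)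
      rw [hb]; ring
    · have h1 := Real.add_one_le_exp (t * x * (z - y) - b)
      have h2 : gaussLik t x z = Real.exp b * (Real.exp (t * x * (z - y) - b) * gaussLik t x y) := by
        unfold gaussLik
        rw [← Real.exp_add, ← Real.exp_add]; congr 1; ring
      simp only [h2]
      refine mul_le_mul_of_nonneg_left ?_ (Real.exp_pos b).le
      nlinarith [gaussLik_pos t x y]
  have := Real.log_le_log (mul_pos (Real.exp_pos b) (gaussMarg_pos t y)) hle
  rw [Real.log_mul (Real.exp_pos b).ne' (gaussMarg_pos t y).ne', Real.log_exp] at this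
  linarith

lemma log_gaussMarg_le (t y : ℝ) : Real.log (gaussMarg μ t y) ≤ y ^ 2 / 2 :=
  (Real.log_le_iff_le_exp (gaussMarg_pos t y)).2 (gaussMarg_le t y)

/-- The tangent at `0` bounds `log g` below linearly, and `gaussLik_le` bounds it above by `y²/2`. A
function above its tangents and trapped between these has slope of at most linear growth. -/
lemma exists_gaussMarg_bounds (hμ : Integrable id μ) (t : ℝ) : ∃ K : ℝ, 0 ≤ K ∧
    (∀ y, |Real.log (gaussMarg μ t y)| ≤ K * (1 + y ^ 2)) ∧
    ∀ y, |gaussScore μ t y| ≤ K * (1 + |y|) := by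
  set A := |Real.log (gaussMarg μ t 0)| + |gaussScore μ t 0| with hA
  have hA0 : 0 ≤ A := by positivity
  have hlow : ∀ y, -(A * (1 + |y|)) ≤ Real.log (gaussMarg μ t y) := fun y => by
    have h := gaussScore_mul_le hμ t 0 y
    have h1 := neg_abs_le (gaussScore μ t 0 * (y - 0))
    rw [abs_mul, sub_zero] at h1
    have h2 := neg_abs_le (Real.log (gaussMarg μ t 0))
    rw [sub_zero] at h
    nlinarith [abs_nonneg y, abs_nonneg (Real.log (gaussMarg μ t 0)),
      abs_nonneg (gaussScore μ t 0), mul_nonneg (abs_nonneg (Real.log (gaussMarg μ t 0)))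
        (abs_nonneg y)]
  refine ⟨2 * A + 2, by positivity, fun y => abs_le.2 ⟨?_, ?_⟩, fun y => ?_⟩
  · have := hlow y
    have h3 : |y| ≤ 1 + y ^ 2 := by rw [← sq_abs]; nlinarith [sq_nonneg (|y| - 1)]
    nlinarith [sq_nonneg y]
  · have := log_gaussMarg_le (μ := μ) t y
    nlinarith [sq_nonneg y, mul_nonneg hA0 (sq_nonneg y)]
  -- Evaluate the tangent at `y` in the points `z = y ± (1 + |y|)`: the gap is at most quadratic in
  -- `1 + |y|`, and dividing by the step leaves a linear bound.
  · have key : ∀ z, |z| ≤ 1 + 2 * |y| → gaussScore μ t y * (z - y) ≤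
        (2 * A + 2) * (1 + |y|) * (1 + |y|) := fun z hz => by
      have h1 := gaussScore_mul_le hμ t y z
      have h2 := log_gaussMarg_le (μ := μ) t z
      have h3 := hlow y
      have h4 : z ^ 2 ≤ (1 + 2 * |y|) ^ 2 := by
        rw [← sq_abs z]; exact pow_le_pow_left₀ (abs_nonneg z) hz 2
      nlinarith [abs_nonneg y, mul_nonneg hA0 (abs_nonneg y),
        mul_nonneg hA0 (sq_nonneg |y|)]
    have hp : 0 < 1 + |y| := by positivity
    have hz : |y + (1 + |y|)| ≤ 1 + 2 * |y| :=
      (abs_add_le _ _).trans (by rw [abs_of_pos hp]; linarith)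
    have hz' : |y - (1 + |y|)| ≤ 1 + 2 * |y| :=
      (abs_sub _ _).trans (by rw [abs_of_pos hp]; linarith)
    have k1 := key _ hz
    have k2 := key _ hz'
    refine abs_le.2 ⟨?_, ?_⟩ <;> refine le_of_mul_le_mul_right ?_ hp <;> linarith

end Marginal

/-! ### Change of measure and Gibbs' inequality -/

lemma gaussianReal_eq_withDensity_gaussLik (t x : ℝ) :
    gaussianReal (t * x) 1 =
      (gaussianReal 0 1).withDensity fun y => ENNReal.ofReal (gaussLik t x y) := by
  rw [gaussianReal_of_var_ne_zero _ one_ne_zero, gaussianReal_of_var_ne_zero _ one_ne_zero,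
    ← withDensity_mul _ (measurable_gaussianPDF 0 1) (by unfold gaussLik; fun_prop)]
  congr 1
  funext y
  rw [Pi.mul_apply, gaussianPDF, gaussianPDF,
    ← ENNReal.ofReal_mul (gaussianPDFReal_nonneg _ _ _)]
  congr 1
  simp only [gaussianPDFReal, gaussLik]
  rw [mul_assoc _ (Real.exp _), ← Real.exp_add]
  congr 2
  push_cast
  ring

lemma ofReal_gaussMarg {μ : Measure ℝ} [IsProbabilityMeasure μ] (t y : ℝ) :
    ENNReal.ofReal (gaussMarg μ t y) = ∫⁻ x, ENNReal.ofReal (gaussLik t x y) ∂μ :=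
  ofReal_integral_eq_lintegral_ofReal (integrable_gaussLik t y)
    (.of_forall fun x => (gaussLik_pos t x y).le)

lemma measurable_ofReal_gaussLik (t : ℝ) :
    Measurable fun p : ℝ × ℝ => ENNReal.ofReal (gaussLik t p.1 p.2) :=
  (continuous_gaussLik t).measurable.ennreal_ofReal

/-- If `r > 0` has integral at most one, then the integral of `log r` is nonpositive. -/
lemma integral_log_nonpos {Ω : Type*} [MeasurableSpace Ω] {P : Measure Ω}
    [IsProbabilityMeasure P] {r : Ω → ℝ} (hr : ∀ ω, 0 < r ω) (hm : Measurable r)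
    (hle : ∫⁻ ω, ENNReal.ofReal (r ω) ∂P ≤ 1) (hlog : Integrable (fun ω => Real.log (r ω)) P) :
    ∫ ω, Real.log (r ω) ∂P ≤ 0 := by
  have hi : Integrable r P := by
    refine ⟨hm.aestronglyMeasurable, ?_⟩
    rw [hasFiniteIntegral_iff_ofReal (.of_forall fun ω => (hr ω).le)]
    exact hle.trans_lt ENNReal.one_lt_top
  have h1 : ∫ ω, r ω ∂P ≤ 1 := by
    rw [integral_eq_lintegral_of_nonneg_ae (.of_forall fun ω => (hr ω).le)
      hm.aestronglyMeasurable]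
    exact ENNReal.toReal_le_of_le_ofReal zero_le_one (by simpa using hle)
  have h2 := integral_mono hlog (hi.sub (integrable_const 1))
    (fun ω => Real.log_le_sub_one_of_pos (hr ω))
  simp only [Pi.sub_apply] at h2
  rw [integral_sub hi (integrable_const 1)] at h2
  simp at h2
  linarith

/-! ### Joint law, output law, information density and Tweedie's formula -/

section Channel

variable {Ω : Type*} [MeasurableSpace Ω] {P : Measure Ω} [IsProbabilityMeasure P] {X N : Ω → ℝ}

lemma measurable_channelOutput (hX : Measurable X) (hN : Measurable N) (t : ℝ) :
    Measurable (channelOutput X N t) := (hX.const_mul t).add hN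

/-- The joint law of input and output. -/
lemma map_prodMk_channelOutput (hX : Measurable X) (hN : Measurable N)
    (hNlaw : P.map N = gaussianReal 0 1) (hXN : IndepFun X N P) (t : ℝ) :
    P.map (fun ω => (X ω, channelOutput X N t ω)) =
      ((P.map X).prod (gaussianReal 0 1)).withDensity
        fun p => ENNReal.ofReal (gaussLik t p.1 p.2) := by
  have hpm : IsProbabilityMeasure (P.map X) := Measure.isProbabilityMeasure_map hX.aemeasurable
  have hT : Measurable fun p : ℝ × ℝ => (p.1, t * p.1 + p.2) := by fun_prop
  have hcomp : (fun ω => (X ω, channelOutput X N t ω)) =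
      (fun p : ℝ × ℝ => (p.1, t * p.1 + p.2)) ∘ fun ω => (X ω, N ω) := rfl
  rw [hcomp, ← Measure.map_map hT (hX.prodMk hN),
    (indepFun_iff_map_prod_eq_prod_map_map hX.aemeasurable hN.aemeasurable).1 hXN, hNlaw]
  refine Measure.ext_of_lintegral _ fun f hf => ?_
  rw [lintegral_map hf hT,
    lintegral_prod (fun p : ℝ × ℝ => f (p.1, t * p.1 + p.2)) (hf.comp hT).aemeasurable,
    lintegral_withDensity_eq_lintegral_mul _ (measurable_ofReal_gaussLik t) hf,
    lintegral_prod _ ((measurable_ofReal_gaussLik t).mul hf).aemeasurable]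
  -- For fixed `x` the output is the noise translated by `t x`.
  refine lintegral_congr fun x => ?_
  have hfx : Measurable fun y => f (x, y) := hf.comp measurable_prodMk_left
  have hlx : Measurable fun y => ENNReal.ofReal (gaussLik t x y) :=
    (measurable_ofReal_gaussLik t).comp measurable_prodMk_left
  have h := lintegral_map (μ := gaussianReal 0 1) hfx (measurable_const_add (t * x))
  rw [gaussianReal_map_const_add, zero_add, gaussianReal_eq_withDensity_gaussLik,
    lintegral_withDensity_eq_lintegral_mul _ hlx hfx] at h
  exact h.symm

lemma lintegral_channelOutput (hX : Measurable X) (hN : Measurable N)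
    (hNlaw : P.map N = gaussianReal 0 1) (hXN : IndepFun X N P) (t : ℝ)
    {f : ℝ × ℝ → ℝ≥0∞} (hf : Measurable f) :
    ∫⁻ ω, f (X ω, channelOutput X N t ω) ∂P =
      ∫⁻ y, ∫⁻ x, ENNReal.ofReal (gaussLik t x y) * f (x, y) ∂(P.map X) ∂(gaussianReal 0 1) := by
  have hpm : IsProbabilityMeasure (P.map X) := Measure.isProbabilityMeasure_map hX.aemeasurable
  rw [← lintegral_map (μ := P) hf (hX.prodMk (measurable_channelOutput hX hN t)),
    map_prodMk_channelOutput hX hN hNlaw hXN,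
    lintegral_withDensity_eq_lintegral_mul _ (measurable_ofReal_gaussLik t) hf,
    lintegral_prod_symm' _ ((measurable_ofReal_gaussLik t).mul hf)]
  rfl

variable [IsProbabilityMeasure (P.map X)]

omit [IsProbabilityMeasure P] in
lemma measurable_ofReal_gaussMarg (hμ : Integrable id (P.map X)) (t : ℝ) :
    Measurable fun y => ENNReal.ofReal (gaussMarg (P.map X) t y) :=
  (continuous_gaussMarg hμ t).measurable.ennreal_ofReal

/-- The law of the output. -/
lemma map_channelOutput (hX : Measurable X) (hN : Measurable N) (hμ : Integrable id (P.map X))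
    (hNlaw : P.map N = gaussianReal 0 1) (hXN : IndepFun X N P) (t : ℝ) :
    P.map (channelOutput X N t) =
      (gaussianReal 0 1).withDensity fun y => ENNReal.ofReal (gaussMarg (P.map X) t y) := by
  refine Measure.ext_of_lintegral _ fun f hf => ?_
  rw [lintegral_map hf (measurable_channelOutput hX hN t),
    lintegral_channelOutput hX hN hNlaw hXN t (f := fun p => f p.2) (hf.comp measurable_snd),
    lintegral_withDensity_eq_lintegral_mul _ (measurable_ofReal_gaussMarg hμ t) hf]
  refine lintegral_congr fun y => ?_
  rw [Pi.mul_apply, ofReal_gaussMarg]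
  exact lintegral_mul_const (f y) ((measurable_ofReal_gaussLik t).comp measurable_prodMk_right)

lemma lintegral_gaussMarg (hX : Measurable X) (hN : Measurable N)
    (hμ : Integrable id (P.map X)) (hNlaw : P.map N = gaussianReal 0 1) (hXN : IndepFun X N P)
    (t : ℝ) : ∫⁻ y, ENNReal.ofReal (gaussMarg (P.map X) t y) ∂(gaussianReal 0 1) = 1 := by
  have h : (P.map (channelOutput X N t)) Set.univ = 1 :=
    (Measure.isProbabilityMeasure_map
      (measurable_channelOutput hX hN t).aemeasurable).measure_univ
  rw [map_channelOutput hX hN hμ hNlaw hXN] at h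
  simpa using h

/-- The density of the joint law with respect to the product of the marginals. -/
lemma map_prodMk_channelOutput_eq_withDensity_prod (hX : Measurable X) (hN : Measurable N)
    (hμ : Integrable id (P.map X)) (hNlaw : P.map N = gaussianReal 0 1) (hXN : IndepFun X N P)
    (t : ℝ) :
    P.map (fun ω => (X ω, channelOutput X N t ω)) =
      ((P.map X).prod (P.map (channelOutput X N t))).withDensity
        fun p => ENNReal.ofReal (gaussLik t p.1 p.2 / gaussMarg (P.map X) t p.2) := by
  have hm := (continuous_gaussMarg hμ t).measurable
  rw [map_prodMk_channelOutput hX hN hNlaw hXN, map_channelOutput hX hN hμ hNlaw hXN]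
  have h1 : Measurable fun p : ℝ × ℝ => ENNReal.ofReal (gaussMarg (P.map X) t p.2) :=
    (measurable_ofReal_gaussMarg hμ t).comp measurable_snd
  have h2 : Measurable fun p : ℝ × ℝ =>
      ENNReal.ofReal (gaussLik t p.1 p.2 / gaussMarg (P.map X) t p.2) :=
    ((continuous_gaussLik t).measurable.div (hm.comp measurable_snd)).ennreal_ofReal
  rw [prod_withDensity_right (measurable_ofReal_gaussMarg hμ t), ← withDensity_mul _ h1 h2]
  congr 1
  funext p
  rw [Pi.mul_apply, ← ENNReal.ofReal_mul (gaussMarg_pos t p.2).le,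
    mul_div_cancel₀ _ (gaussMarg_pos t p.2).ne']

lemma mutualInfo_channelOutput (hX : Measurable X) (hN : Measurable N)
    (hμ : Integrable id (P.map X)) (hNlaw : P.map N = gaussianReal 0 1) (hXN : IndepFun X N P)
    (t : ℝ)
    (hi : Integrable (fun ω => (t * X ω * channelOutput X N t ω - (t * X ω) ^ 2 / 2)
      - Real.log (gaussMarg (P.map X) t (channelOutput X N t ω))) P) :
    mutualInfo X (channelOutput X N t) P ≠ ∞ ∧
    (mutualInfo X (channelOutput X N t) P).toReal =
      ∫ ω, ((t * X ω * channelOutput X N t ω - (t * X ω) ^ 2 / 2)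
      - Real.log (gaussMarg (P.map X) t (channelOutput X N t ω))) ∂P := by
  have hY := measurable_channelOutput hX hN t
  have hm := (continuous_gaussMarg hμ t).measurable
  have hp : IsProbabilityMeasure (P.map (channelOutput X N t)) :=
    Measure.isProbabilityMeasure_map hY.aemeasurable
  have hp' : IsProbabilityMeasure (P.map fun ω => (X ω, channelOutput X N t ω)) :=
    Measure.isProbabilityMeasure_map (hX.prodMk hY).aemeasurable
  have hd : Measurable fun p : ℝ × ℝ =>
      ENNReal.ofReal (gaussLik t p.1 p.2 / gaussMarg (P.map X) t p.2) :=
    ((continuous_gaussLik t).measurable.div (hm.comp measurable_snd)).ennreal_ofReal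
  have heq := map_prodMk_channelOutput_eq_withDensity_prod hX hN hμ hNlaw hXN t
  have hac : P.map (fun ω => (X ω, channelOutput X N t ω)) ≪
      (P.map X).prod (P.map (channelOutput X N t)) := by
    rw [heq]; exact withDensity_absolutelyContinuous _ _
  set l : ℝ × ℝ → ℝ := fun p => (t * p.1 * p.2 - (t * p.1) ^ 2 / 2)
      - Real.log (gaussMarg (P.map X) t p.2) with hl
  have hlm : Measurable l := by
    have : Measurable fun p : ℝ × ℝ => gaussMarg (P.map X) t p.2 := hm.comp measurable_snd
    fun_prop
  have hllr : llr (P.map fun ω => (X ω, channelOutput X N t ω))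
      ((P.map X).prod (P.map (channelOutput X N t)))
      =ᵐ[P.map fun ω => (X ω, channelOutput X N t ω)] l := by
    -- The density is identified almost everywhere for the product of the marginals; absolute
    -- continuity carries this to the joint law.
    refine hac.ae_le ?_
    have h := Measure.rnDeriv_withDensity ((P.map X).prod (P.map (channelOutput X N t))) hd
    rw [← heq] at h
    filter_upwards [h] with p hp
    rw [llr, hp, ENNReal.toReal_ofReal (div_pos (gaussLik_pos _ _ _) (gaussMarg_pos t p.2)).le,
      Real.log_div (gaussLik_pos _ _ _).ne' (gaussMarg_pos t p.2).ne', gaussLik, Real.log_exp]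
  have hli : Integrable l (P.map fun ω => (X ω, channelOutput X N t ω)) :=
    (integrable_map_measure hlm.aestronglyMeasurable (hX.prodMk hY).aemeasurable).2 hi
  refine ⟨InformationTheory.klDiv_ne_top hac (hli.congr hllr.symm), ?_⟩
  rw [mutualInfo, InformationTheory.toReal_klDiv_of_measure_eq hac (by simp),
    integral_congr_ae hllr,
    integral_map (hX.prodMk hY).aemeasurable hlm.aestronglyMeasurable]

/-- The score of the output law at the output is the conditional mean of `t X`. -/
lemma gaussScore_ae_eq_condExp (hX : Measurable X) (hN : Measurable N)
    (hμ : Integrable id (P.map X)) (hNlaw : P.map N = gaussianReal 0 1) (hXN : IndepFun X N P)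
    (t : ℝ) (hXi : Integrable X P)
    (hs : Integrable (fun ω => gaussScore (P.map X) t (channelOutput X N t ω)) P) :
    (fun ω => gaussScore (P.map X) t (channelOutput X N t ω)) =ᵐ[P]
      fun ω => t * condMean X (channelOutput X N t) P ω := by
  have hY := measurable_channelOutput hX hN t
  have hm := (continuous_gaussMarg hμ t).measurable
  have hsm := measurable_gaussScore hμ t
  have key : (fun ω => gaussScore (P.map X) t (channelOutput X N t ω)) =ᵐ[P]
      P[fun ω => t * X ω | (inferInstance : MeasurableSpace ℝ).comap (channelOutput X N t)] := by
    refine ae_eq_condExp_of_forall_setIntegral_eq hY.comap_le (hXi.const_mul t)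
      (fun _ _ _ => hs.integrableOn) ?_
      (hsm.comp (comap_measurable _)).stronglyMeasurable.aestronglyMeasurable
    rintro _ ⟨B, hB, rfl⟩ -
    rw [← integral_indicator (hY hB), ← integral_indicator (hY hB)]
    have h1 : ∫ ω, (channelOutput X N t ⁻¹' B).indicator
          (fun ω => gaussScore (P.map X) t (channelOutput X N t ω)) ω ∂P
        = ∫ y, B.indicator (gaussScore (P.map X) t) y ∂(P.map (channelOutput X N t)) := by
      rw [integral_map hY.aemeasurable (hsm.indicator hB).aestronglyMeasurable]; rfl
    have hfm : Measurable fun p : ℝ × ℝ => B.indicator (fun _ => t * p.1) p.2 := by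
      have : (fun p : ℝ × ℝ => B.indicator (fun _ => t * p.1) p.2) =
        (Prod.snd ⁻¹' B).indicator fun p => t * p.1 := rfl
      rw [this]
      exact (measurable_fst.const_mul t).indicator (measurable_snd hB)
    have h2 : ∫ ω, (channelOutput X N t ⁻¹' B).indicator (fun ω => t * X ω) ω ∂P
        = ∫ p, B.indicator (fun _ => t * p.1) p.2
          ∂(P.map fun ω => (X ω, channelOutput X N t ω)) := by
      rw [integral_map (hX.prodMk hY).aemeasurable hfm.aestronglyMeasurable]; rfl
    have hfi : Integrable (fun p : ℝ × ℝ => B.indicator (fun _ => t * p.1) p.2)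
        (P.map fun ω => (X ω, channelOutput X N t ω)) :=
      (integrable_map_measure hfm.aestronglyMeasurable (hX.prodMk hY).aemeasurable).2
        ((hXi.const_mul t).indicator (hY hB))
    have hfin : ∀ᵐ p ∂((P.map X).prod (gaussianReal 0 1)),
        ENNReal.ofReal (gaussLik t p.1 p.2) < ∞ := .of_forall fun _ => ENNReal.ofReal_lt_top
    rw [h1, h2]
    rw [map_prodMk_channelOutput hX hN hNlaw hXN] at hfi ⊢
    rw [integrable_withDensity_iff_integrable_smul' (measurable_ofReal_gaussLik t) hfin] at hfi
    -- Integrating over `x` first leaves the numerator of the score, which is the score times the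
    -- output density.
    rw [integral_withDensity_eq_integral_toReal_smul (measurable_ofReal_gaussLik t) hfin,
      integral_prod_symm _ hfi, map_channelOutput hX hN hμ hNlaw hXN,
      integral_withDensity_eq_integral_toReal_smul (measurable_ofReal_gaussMarg hμ t)
        (.of_forall fun _ => ENNReal.ofReal_lt_top)]
    refine integral_congr_ae (.of_forall fun y => ?_)
    simp only [smul_eq_mul, ENNReal.toReal_ofReal (gaussLik_pos t _ y).le,
      ENNReal.toReal_ofReal (gaussMarg_pos (μ := P.map X) t y).le]
    by_cases hy : y ∈ B
    · simp only [Set.indicator_of_mem hy]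
      rw [mul_comm, gaussScore_mul_gaussMarg]
      simp only [mul_comm]
    · simp [Set.indicator_of_notMem hy]
  refine key.trans ?_
  exact condExp_smul t X _

end Channel

/-! ### Moments and differentiation of the expected log-density -/

section Channel

variable {Ω : Type*} [MeasurableSpace Ω] {P : Measure Ω} [IsProbabilityMeasure P] {X N : Ω → ℝ}

omit [IsProbabilityMeasure P] in
lemma memLp_two_of_map_eq_gaussianReal (hN : Measurable N) (hNlaw : P.map N = gaussianReal 0 1) :
    MemLp N 2 P := by
  have h : MemLp id 2 (P.map N) := hNlaw ▸ memLp_id_gaussianReal 2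
  exact (memLp_map_measure_iff aestronglyMeasurable_id hN.aemeasurable).1 h

omit [IsProbabilityMeasure P] in
lemma integral_eq_zero_of_map_eq_gaussianReal (hN : Measurable N)
    (hNlaw : P.map N = gaussianReal 0 1) : ∫ ω, N ω ∂P = 0 := by
  have h := integral_map (μ := P) hN.aemeasurable (f := id) aestronglyMeasurable_id
  rw [hNlaw] at h
  simpa using h.symm

omit [IsProbabilityMeasure P] in
lemma integral_mul_noise_eq_zero (hX : Measurable X) (hN : Measurable N)
    (hNlaw : P.map N = gaussianReal 0 1) (hXN : IndepFun X N P) : ∫ ω, X ω * N ω ∂P = 0 := by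
  have h := hXN.integral_mul_eq_mul_integral hX.aestronglyMeasurable hN.aestronglyMeasurable
  rw [integral_eq_zero_of_map_eq_gaussianReal hN hNlaw, mul_zero] at h
  exact h

lemma integrable_id_map (hX : Measurable X) (hX2 : MemLp X 2 P) : Integrable id (P.map X) :=
  (integrable_map_measure aestronglyMeasurable_id hX.aemeasurable).2
    (hX2.integrable one_le_two)

omit [IsProbabilityMeasure P] in
lemma memLp_channelOutput (hX2 : MemLp X 2 P) (hN2 : MemLp N 2 P) (t : ℝ) :
    MemLp (channelOutput X N t) 2 P := (hX2.const_mul t).add hN2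

lemma integrable_log_gaussMarg (hX : Measurable X) (hN : Measurable N) (hX2 : MemLp X 2 P)
    (hN2 : MemLp N 2 P) [IsProbabilityMeasure (P.map X)] (s t : ℝ) :
    Integrable (fun ω => Real.log (gaussMarg (P.map X) s (channelOutput X N t ω))) P := by
  have hμ := integrable_id_map hX hX2
  obtain ⟨K, -, hK, -⟩ := exists_gaussMarg_bounds hμ s
  refine (((integrable_const 1).add (memLp_channelOutput hX2 hN2 t).integrable_sq).const_mul
    K).mono' ?_ (.of_forall fun ω => hK _)
  exact (Real.measurable_log.comp ((continuous_gaussMarg hμ s).measurable.comp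
    (measurable_channelOutput hX hN t))).aestronglyMeasurable

lemma integrable_gaussScore (hX : Measurable X) (hN : Measurable N) (hX2 : MemLp X 2 P)
    (hN2 : MemLp N 2 P) [IsProbabilityMeasure (P.map X)] (s t : ℝ) :
    Integrable (fun ω => gaussScore (P.map X) s (channelOutput X N t ω)) P := by
  have hμ := integrable_id_map hX hX2
  obtain ⟨K, -, -, hK⟩ := exists_gaussMarg_bounds hμ s
  refine (((integrable_const 1).add ((memLp_channelOutput hX2 hN2 t).integrable
    one_le_two).abs).const_mul K).mono' ?_ (.of_forall fun ω => hK _)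
  exact ((measurable_gaussScore hμ s).comp
    (measurable_channelOutput hX hN t)).aestronglyMeasurable

/-- Differentiation of `t ↦ E[log (gaussMarg s (Y_t))]` for a fixed `s`. -/
lemma hasDerivAt_integral_log_gaussMarg (hX : Measurable X) (hN : Measurable N)
    (hX2 : MemLp X 2 P) (hN2 : MemLp N 2 P) [IsProbabilityMeasure (P.map X)] (s : ℝ) :
    HasDerivAt (fun t => ∫ ω, Real.log (gaussMarg (P.map X) s (channelOutput X N t ω)) ∂P)
      (∫ ω, X ω * gaussScore (P.map X) s (channelOutput X N s ω) ∂P) s := by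
  have hμ := integrable_id_map hX hX2
  obtain ⟨K, hK0, -, hK⟩ := exists_gaussMarg_bounds hμ s
  -- The dominating function is a product of two square-integrable variables, so the second moment
  -- of `X` suffices.
  have hb : Integrable (fun ω => |X ω| * (K * (1 + ((|s| + 1) * |X ω| + |N ω|)))) P := by
    have hXa : MemLp (fun ω => |X ω|) 2 P := hX2.norm
    have hNa : MemLp (fun ω => |N ω|) 2 P := hN2.norm
    have h1 : MemLp (fun ω => (|s| + 1) * |X ω| + |N ω|) 2 P := (hXa.const_mul (|s| + 1)).add hNa
    have h2 : MemLp (fun ω => 1 + ((|s| + 1) * |X ω| + |N ω|)) 2 P :=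
      (memLp_const (1 : ℝ)).add h1
    exact hXa.integrable_mul (h2.const_mul K)
  have hbd : ∀ ω, ∀ t ∈ Metric.ball s 1,
      ‖X ω * gaussScore (P.map X) s (channelOutput X N t ω)‖ ≤
        |X ω| * (K * (1 + ((|s| + 1) * |X ω| + |N ω|))) := fun ω t ht => by
    rw [norm_mul, Real.norm_eq_abs, Real.norm_eq_abs]
    refine mul_le_mul_of_nonneg_left ((hK _).trans ?_) (abs_nonneg _)
    have ht' : |t| ≤ |s| + 1 := by
      have h1 : |t - s| < 1 := by simpa [Real.dist_eq] using ht
      have h2 := abs_sub_abs_le_abs_sub t s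
      linarith
    have h3 : |channelOutput X N t ω| ≤ (|s| + 1) * |X ω| + |N ω| := by
      refine (abs_add_le _ _).trans ?_
      rw [abs_mul]
      gcongr
    gcongr
  have hdiff : ∀ ω, ∀ t ∈ Metric.ball s 1,
      HasDerivAt (fun t => Real.log (gaussMarg (P.map X) s (channelOutput X N t ω)))
        (X ω * gaussScore (P.map X) s (channelOutput X N t ω)) t := fun ω t _ => by
    have h1 : HasDerivAt (fun t => channelOutput X N t ω) (X ω) t := by
      simpa [channelOutput] using ((hasDerivAt_id t).mul_const (X ω)).add_const (N ω)
    have h2 := (hasDerivAt_log_gaussMarg hμ s (channelOutput X N t ω)).comp t h1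
    rw [mul_comm] at h2
    exact h2
  have hmeas : AEStronglyMeasurable
      (fun ω => X ω * gaussScore (P.map X) s (channelOutput X N s ω)) P :=
    hX.aestronglyMeasurable.mul (integrable_gaussScore hX hN hX2 hN2 s s).1
  exact (hasDerivAt_integral_of_dominated_loc_of_deriv_le
    (F := fun t ω => Real.log (gaussMarg (P.map X) s (channelOutput X N t ω)))
    (F' := fun t ω => X ω * gaussScore (P.map X) s (channelOutput X N t ω))
    (Metric.ball_mem_nhds s one_pos)
    (.of_forall fun t => (integrable_log_gaussMarg hX hN hX2 hN2 s t).1)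
    (integrable_log_gaussMarg hX hN hX2 hN2 s s)
    hmeas (.of_forall hbd) hb (.of_forall hdiff)).2

omit [IsProbabilityMeasure P] in
lemma integrable_log_gaussLik (hX2 : MemLp X 2 P) (hN2 : MemLp N 2 P) (s t : ℝ) :
    Integrable (fun ω => s * X ω * channelOutput X N t ω - (s * X ω) ^ 2 / 2) P :=
  ((hX2.const_mul s).integrable_mul (memLp_channelOutput hX2 hN2 t)).sub
    ((hX2.const_mul s).integrable_sq.div_const 2)

-- The cross term `s X N` has mean zero. Keeping `s` and `t` separate yields the relative entropy of
-- the joint laws: the value at `(t, t)` minus that at `(s, t)` is `(t - s)²/2 · E[X²]`.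
omit [IsProbabilityMeasure P] in
lemma integral_log_gaussLik (hX : Measurable X) (hN : Measurable N) (hX2 : MemLp X 2 P)
    (hNlaw : P.map N = gaussianReal 0 1) (hXN : IndepFun X N P) (s t : ℝ) :
    ∫ ω, (s * X ω * channelOutput X N t ω - (s * X ω) ^ 2 / 2) ∂P =
      (s * t - s ^ 2 / 2) * ∫ ω, X ω ^ 2 ∂P := by
  have hN2 := memLp_two_of_map_eq_gaussianReal hN hNlaw
  have h : ∀ ω, s * X ω * channelOutput X N t ω - (s * X ω) ^ 2 / 2 =
      (s * t - s ^ 2 / 2) * X ω ^ 2 + s * (X ω * N ω) := fun ω => by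
    unfold channelOutput; ring
  simp_rw [h]
  have hXNi : Integrable (fun ω => X ω * N ω) P := hX2.integrable_mul hN2
  rw [integral_add (hX2.integrable_sq.const_mul _) (hXNi.const_mul s),
    integral_const_mul, integral_const_mul, integral_mul_noise_eq_zero hX hN hNlaw hXN]
  ring

/-- Changing the density inside the expected log-likelihood costs a nonnegative amount, a
relative entropy between two output laws. -/
lemma integral_log_gaussMarg_le (hX : Measurable X) (hN : Measurable N) (hX2 : MemLp X 2 P)
    (hNlaw : P.map N = gaussianReal 0 1) (hXN : IndepFun X N P)
    [IsProbabilityMeasure (P.map X)] (s t : ℝ) :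
    ∫ ω, Real.log (gaussMarg (P.map X) s (channelOutput X N t ω)) ∂P ≤
      ∫ ω, Real.log (gaussMarg (P.map X) t (channelOutput X N t ω)) ∂P := by
  have hN2 := memLp_two_of_map_eq_gaussianReal hN hNlaw
  have hμ := integrable_id_map hX hX2
  have hY := measurable_channelOutput hX hN t
  have hm := fun u => (continuous_gaussMarg hμ u).measurable
  have hi := fun u => integrable_log_gaussMarg hX hN hX2 hN2 u t
  have hlog : ∀ y, Real.log (gaussMarg (P.map X) s y / gaussMarg (P.map X) t y) =
      Real.log (gaussMarg (P.map X) s y) - Real.log (gaussMarg (P.map X) t y) := fun y =>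
    Real.log_div (gaussMarg_pos s y).ne' (gaussMarg_pos t y).ne'
  -- `r` is the density of the law of `Y_s` against that of `Y_t`, evaluated at `Y_t`, so its mean
  -- is one.
  have h := integral_log_nonpos (P := P)
    (r := fun ω => gaussMarg (P.map X) s (channelOutput X N t ω) /
      gaussMarg (P.map X) t (channelOutput X N t ω))
    (fun ω => div_pos (gaussMarg_pos _ _) (gaussMarg_pos _ _))
    (((hm s).comp hY).div ((hm t).comp hY)) ?_ ?_
  · simp_rw [hlog] at h
    rw [integral_sub (hi s) (hi t)] at h
    linarith
  · have hf : Measurable fun y =>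
        ENNReal.ofReal (gaussMarg (P.map X) s y / gaussMarg (P.map X) t y) :=
      ((hm s).div (hm t)).ennreal_ofReal
    rw [← lintegral_map (μ := P) hf hY, map_channelOutput hX hN hμ hNlaw hXN,
      lintegral_withDensity_eq_lintegral_mul _ (measurable_ofReal_gaussMarg hμ t) hf,
      ← lintegral_gaussMarg hX hN hμ hNlaw hXN s]
    refine le_of_eq (lintegral_congr fun y => ?_)
    rw [Pi.mul_apply, ← ENNReal.ofReal_mul (gaussMarg_pos t y).le,
      mul_div_cancel₀ _ (gaussMarg_pos t y).ne']
  · simp_rw [hlog]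
    exact (hi s).sub (hi t)

/-- The relative entropy between two output laws is at most the one between the joint laws. -/
lemma integral_log_gaussMarg_le_add (hX : Measurable X) (hN : Measurable N) (hX2 : MemLp X 2 P)
    (hNlaw : P.map N = gaussianReal 0 1) (hXN : IndepFun X N P)
    [IsProbabilityMeasure (P.map X)] (s t : ℝ) :
    ∫ ω, Real.log (gaussMarg (P.map X) t (channelOutput X N t ω)) ∂P ≤
      ∫ ω, Real.log (gaussMarg (P.map X) s (channelOutput X N t ω)) ∂P +
        (t - s) ^ 2 / 2 * ∫ ω, X ω ^ 2 ∂P := by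
  have hN2 := memLp_two_of_map_eq_gaussianReal hN hNlaw
  have hμ := integrable_id_map hX hX2
  have hY := measurable_channelOutput hX hN t
  have hm := fun u => (continuous_gaussMarg hμ u).measurable
  have hi := fun u => integrable_log_gaussMarg hX hN hX2 hN2 u t
  have hl := fun u => integrable_log_gaussLik (P := P) hX2 hN2 u t
  have hpos : ∀ x y, 0 < gaussLik s x y / gaussLik t x y *
      (gaussMarg (P.map X) t y / gaussMarg (P.map X) s y) := fun x y =>
    mul_pos (div_pos (gaussLik_pos _ _ _) (gaussLik_pos _ _ _))
      (div_pos (gaussMarg_pos _ _) (gaussMarg_pos _ _))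
  have hlog : ∀ x y, Real.log (gaussLik s x y / gaussLik t x y *
      (gaussMarg (P.map X) t y / gaussMarg (P.map X) s y)) =
      ((s * x * y - (s * x) ^ 2 / 2) - (t * x * y - (t * x) ^ 2 / 2)) +
      (Real.log (gaussMarg (P.map X) t y) - Real.log (gaussMarg (P.map X) s y)) := fun x y => by
    rw [Real.log_mul (div_pos (gaussLik_pos _ _ _) (gaussLik_pos _ _ _)).ne'
      (div_pos (gaussMarg_pos _ _) (gaussMarg_pos _ _)).ne',
      Real.log_div (gaussLik_pos _ _ _).ne' (gaussLik_pos _ _ _).ne',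
      Real.log_div (gaussMarg_pos _ _).ne' (gaussMarg_pos _ _).ne', gaussLik, gaussLik,
      Real.log_exp, Real.log_exp]
  have hmeas : Measurable fun p : ℝ × ℝ => gaussLik s p.1 p.2 / gaussLik t p.1 p.2 *
      (gaussMarg (P.map X) t p.2 / gaussMarg (P.map X) s p.2) :=
    ((continuous_gaussLik s).measurable.div (continuous_gaussLik t).measurable).mul
      (((hm t).comp measurable_snd).div ((hm s).comp measurable_snd))
  -- `r` is the ratio of the posterior densities of `X` given the output, for scalings `s` and `t`.
  -- Averaging over `x` cancels `g_s` and leaves the total mass of `g_t`; this is the chain rule for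
  -- relative entropy.
  have h := integral_log_nonpos (P := P)
    (r := fun ω => gaussLik s (X ω) (channelOutput X N t ω) /
        gaussLik t (X ω) (channelOutput X N t ω) *
      (gaussMarg (P.map X) t (channelOutput X N t ω) /
        gaussMarg (P.map X) s (channelOutput X N t ω)))
    (fun ω => hpos _ _) (hmeas.comp (hX.prodMk hY)) ?_ ?_
  · simp_rw [hlog] at h
    rw [integral_add (by exact (hl s).sub (hl t)) (by exact (hi t).sub (hi s)),
      integral_sub (hl s) (hl t),
      integral_sub (hi t) (hi s), integral_log_gaussLik hX hN hX2 hNlaw hXN,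
      integral_log_gaussLik hX hN hX2 hNlaw hXN] at h
    linarith
  · rw [lintegral_channelOutput hX hN hNlaw hXN t (f := fun p => ENNReal.ofReal
      (gaussLik s p.1 p.2 / gaussLik t p.1 p.2 *
      (gaussMarg (P.map X) t p.2 / gaussMarg (P.map X) s p.2))) hmeas.ennreal_ofReal,
      ← lintegral_gaussMarg hX hN hμ hNlaw hXN t]
    refine le_of_eq (lintegral_congr fun y => ?_)
    have h1 : ∀ x, ENNReal.ofReal (gaussLik t x y) * ENNReal.ofReal
        (gaussLik s x y / gaussLik t x y *
          (gaussMarg (P.map X) t y / gaussMarg (P.map X) s y)) =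
        ENNReal.ofReal (gaussLik s x y) *
          ENNReal.ofReal (gaussMarg (P.map X) t y / gaussMarg (P.map X) s y) := fun x => by
      rw [← ENNReal.ofReal_mul (gaussLik_pos _ _ _).le,
        ← ENNReal.ofReal_mul (gaussLik_pos _ _ _).le, ← mul_assoc,
        mul_div_cancel₀ _ (gaussLik_pos t x y).ne']
    simp only [h1]
    rw [lintegral_mul_const _ (continuous_gaussLik_left s y).measurable.ennreal_ofReal,
      ← ofReal_gaussMarg, ← ENNReal.ofReal_mul (gaussMarg_pos s y).le,
      mul_div_cancel₀ _ (gaussMarg_pos s y).ne']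
  · simp_rw [hlog]
    exact ((hl s).sub (hl t)).add ((hi t).sub (hi s))

/-- The relative entropy of the output law with respect to `N(0, 1)` is differentiable in the
scaling factor. -/
lemma hasDerivAt_integral_log_gaussMarg_self (hX : Measurable X) (hN : Measurable N)
    (hX2 : MemLp X 2 P) (hNlaw : P.map N = gaussianReal 0 1) (hXN : IndepFun X N P)
    [IsProbabilityMeasure (P.map X)] (s : ℝ) :
    HasDerivAt (fun t => ∫ ω, Real.log (gaussMarg (P.map X) t (channelOutput X N t ω)) ∂P)
      (∫ ω, X ω * gaussScore (P.map X) s (channelOutput X N s ω) ∂P) s := by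
  have hN2 := memLp_two_of_map_eq_gaussianReal hN hNlaw
  have h1 := hasDerivAt_integral_log_gaussMarg hX hN hX2 hN2 s
  set D : ℝ → ℝ := fun t => ∫ ω, Real.log (gaussMarg (P.map X) t (channelOutput X N t ω)) ∂P
  set G : ℝ → ℝ := fun t => ∫ ω, Real.log (gaussMarg (P.map X) s (channelOutput X N t ω)) ∂P
  have hlow : ∀ t, G t ≤ D t := fun t => integral_log_gaussMarg_le hX hN hX2 hNlaw hXN s t
  have hup : ∀ t, D t ≤ G t + (t - s) ^ 2 / 2 * ∫ ω, X ω ^ 2 ∂P := fun t =>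
    integral_log_gaussMarg_le_add hX hN hX2 hNlaw hXN s t
  have hR : HasDerivAt (fun t => D t - G t) 0 s := by
    rw [hasDerivAt_iff_isLittleO]
    -- The difference vanishes at `s` and is squeezed between `0` and a multiple of `(t - s)²`.
    refine Asymptotics.IsBigO.trans_isLittleO (g := fun t => (t - s) ^ 2) ?_ ?_
    · refine Asymptotics.IsBigO.of_bound ((∫ ω, X ω ^ 2 ∂P) / 2) (.of_forall fun t => ?_)
      have h2 := hlow t
      have h3 := hup t
      have h4 : D s = G s := rfl
      rw [h4, sub_self, sub_zero, smul_zero, sub_zero, Real.norm_of_nonneg (sub_nonneg.2 h2),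
        Real.norm_of_nonneg (sq_nonneg _)]
      linarith
    · simpa using Asymptotics.isLittleO_pow_sub_sub s one_lt_two
  have h := hR.add h1
  rw [zero_add] at h
  exact h.congr_of_eventuallyEq (.of_forall fun t => (sub_add_cancel (D t) (G t)).symm)

/-! ### Conditional mean, mean-squared error and the derivative of the information -/

/-- The error `X - E[X|Y]` is orthogonal to `E[X|Y]`: pull the conditional mean out of the
conditional expectation and integrate. -/
lemma integral_mul_condMean {Y : Ω → ℝ} (hY : Measurable Y) (hX2 : MemLp X 2 P) :
    ∫ ω, X ω * condMean X Y P ω ∂P = ∫ ω, condMean X Y P ω ^ 2 ∂P := by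
  have hc : MemLp (condMean X Y P) 2 P := hX2.condExp one_le_two
  have h := condExp_mul_of_stronglyMeasurable_right (μ := P) (f := X) (g := condMean X Y P)
    (m := (inferInstance : MeasurableSpace ℝ).comap Y) stronglyMeasurable_condExp
    (hX2.integrable_mul hc) (hX2.integrable one_le_two)
  have h2 := integral_condExp (μ := P) hY.comap_le (f := X * condMean X Y P)
  rw [integral_congr_ae h] at h2
  refine h2.symm.trans (integral_congr_ae (.of_forall fun ω => ?_))
  exact (sq (condMean X Y P ω)).symm

lemma mmse_eq_sub {Y : Ω → ℝ} (hY : Measurable Y) (hX2 : MemLp X 2 P) :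
    mmse X Y P = ∫ ω, X ω ^ 2 ∂P - ∫ ω, condMean X Y P ω ^ 2 ∂P := by
  have hc : MemLp (condMean X Y P) 2 P := hX2.condExp one_le_two
  have h : ∀ ω, (X ω - condMean X Y P ω) ^ 2 =
      X ω ^ 2 - 2 * (X ω * condMean X Y P ω) + condMean X Y P ω ^ 2 := fun ω => by ring
  have hi : Integrable (fun ω => X ω * condMean X Y P ω) P := hX2.integrable_mul hc
  unfold mmse
  simp_rw [h]
  rw [integral_add (by exact hX2.integrable_sq.sub (hi.const_mul 2)) hc.integrable_sq,
    integral_sub hX2.integrable_sq (hi.const_mul 2), integral_const_mul,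
    integral_mul_condMean hY hX2]
  ring

lemma mutualInfo_channelOutput_eq (hX : Measurable X) (hN : Measurable N) (hX2 : MemLp X 2 P)
    (hNlaw : P.map N = gaussianReal 0 1) (hXN : IndepFun X N P) (t : ℝ) :
    mutualInfo X (channelOutput X N t) P ≠ ∞ ∧
    (mutualInfo X (channelOutput X N t) P).toReal = t ^ 2 / 2 * ∫ ω, X ω ^ 2 ∂P -
      ∫ ω, Real.log (gaussMarg (P.map X) t (channelOutput X N t ω)) ∂P := by
  have hp : IsProbabilityMeasure (P.map X) := Measure.isProbabilityMeasure_map hX.aemeasurable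
  have hN2 := memLp_two_of_map_eq_gaussianReal hN hNlaw
  have hl := integrable_log_gaussLik (P := P) hX2 hN2 t t
  have hi := integrable_log_gaussMarg hX hN hX2 hN2 t t
  obtain ⟨h1, h2⟩ := mutualInfo_channelOutput hX hN (integrable_id_map hX hX2) hNlaw hXN t
    (hl.sub hi)
  refine ⟨h1, ?_⟩
  rw [h2, integral_sub hl hi, integral_log_gaussLik hX hN hX2 hNlaw hXN]
  ring

/-- The derivative of the mutual information in the scaling factor. -/
lemma hasDerivAt_mutualInfo_channelOutput (hX : Measurable X) (hN : Measurable N)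
    (hX2 : MemLp X 2 P) (hNlaw : P.map N = gaussianReal 0 1) (hXN : IndepFun X N P) (s : ℝ) :
    HasDerivAt (fun t : ℝ => (mutualInfo X (channelOutput X N t) P).toReal)
      (s * mmse X (channelOutput X N s) P) s := by
  have hp : IsProbabilityMeasure (P.map X) := Measure.isProbabilityMeasure_map hX.aemeasurable
  have hN2 := memLp_two_of_map_eq_gaussianReal hN hNlaw
  have hY := measurable_channelOutput hX hN s
  have heq : (fun t : ℝ => (mutualInfo X (channelOutput X N t) P).toReal) = fun t =>
      t ^ 2 / 2 * (∫ ω, X ω ^ 2 ∂P) -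
        ∫ ω, Real.log (gaussMarg (P.map X) t (channelOutput X N t ω)) ∂P :=
    funext fun t => (mutualInfo_channelOutput_eq hX hN hX2 hNlaw hXN t).2
  have hsc : ∫ ω, X ω * gaussScore (P.map X) s (channelOutput X N s ω) ∂P =
      s * ∫ ω, condMean X (channelOutput X N s) P ω ^ 2 ∂P := by
    rw [← integral_mul_condMean hY hX2, ← integral_const_mul]
    refine integral_congr_ae ?_
    filter_upwards [gaussScore_ae_eq_condExp hX hN (integrable_id_map hX hX2) hNlaw hXN s
      (hX2.integrable one_le_two) (integrable_gaussScore hX hN hX2 hN2 s s)] with ω hω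
    rw [hω]; ring
  have hsq : HasDerivAt (fun t : ℝ => t ^ 2 / 2 * ∫ ω, X ω ^ 2 ∂P) (s * ∫ ω, X ω ^ 2 ∂P) s := by
    have h := ((hasDerivAt_pow 2 s).div_const 2).mul_const (∫ ω, X ω ^ 2 ∂P)
    refine h.congr_deriv ?_
    norm_num
  rw [heq, mmse_eq_sub hY hX2, mul_sub, ← hsc]
  exact hsq.sub (hasDerivAt_integral_log_gaussMarg_self hX hN hX2 hNlaw hXN s)

end Channel

/-! ### Quadratic Bregman divergence and conclusion -/

/-- The first-order Taylor remainder of a quadratic is exact, whatever the sign of `φ`; convexity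
plays no role. -/
lemma bregmanDiv_const_mul_sq (φ x y : ℝ) :
    bregmanDiv (fun x : ℝ => φ * x ^ 2) x y = φ * (x - y) ^ 2 := by
  have h : HasDerivAt (fun x : ℝ => φ * x ^ 2) (φ * (2 * y)) y := by
    simpa using (hasDerivAt_pow 2 y).const_mul φ
  rw [bregmanDiv, h.hasGradientAt'.gradient, RCLike.inner_apply, RCLike.conj_to_real]
  ring

lemma isBregmanGenerator_const_mul_sq {φ : ℝ} (hφ : 0 < φ) :
    IsBregmanGenerator (fun x : ℝ => φ * x ^ 2) where
  nonneg x := by positivity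
  contDiff := by fun_prop
  strictConvexOn := by
    have h := even_two.strictConvexOn_pow two_ne_zero
    refine ⟨convex_univ, fun x _ y _ hxy a b ha hb hab => ?_⟩
    have := mul_lt_mul_of_pos_left (h.2 trivial trivial hxy ha hb hab) hφ
    simp only [smul_eq_mul] at this ⊢
    linarith

theorem mainTheorem8 {Ω : Type*} [MeasurableSpace Ω] (P : Measure Ω) [IsProbabilityMeasure P]
    (X N : Ω → ℝ) (hX : Measurable X) (hN : Measurable N)
    (hX2 : MemLp X 2 P)
    (hNlaw : P.map N = gaussianReal 0 1)
    (hXN : IndepFun X N P)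
    (φ : ℝ) :
    -- the mutual information is finite for every scaling factor
    (∀ t : ℝ, mutualInfo X (channelOutput X N t) P ≠ ∞) ∧
    -- for positive scaling, `F(x) = φ x²` generates a classical Bregman divergence
    (0 < φ → IsBregmanGenerator (fun x : ℝ => φ * x ^ 2)) ∧
    -- the two expectations are those of integrable random variables
    Integrable (fun ω => bregmanDiv (fun x : ℝ => φ * x ^ 2) (X ω)
      (condMean X (channelOutput X N φ) P ω)) P ∧
    Integrable (fun ω => (X ω - condMean X (channelOutput X N φ) P ω) ^ 2) P ∧
    -- the Bregman representation of the derivative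
    HasDerivAt (fun t : ℝ => (mutualInfo X (channelOutput X N t) P).toReal)
      (∫ ω, bregmanDiv (fun x : ℝ => φ * x ^ 2) (X ω)
        (condMean X (channelOutput X N φ) P ω) ∂P) φ ∧
    -- the equivalent form in terms of the minimum mean-squared error
    (∫ ω, bregmanDiv (fun x : ℝ => φ * x ^ 2) (X ω)
        (condMean X (channelOutput X N φ) P ω) ∂P) = φ * mmse X (channelOutput X N φ) P ∧
    HasDerivAt (fun t : ℝ => (mutualInfo X (channelOutput X N t) P).toReal)
      (φ * mmse X (channelOutput X N φ) P) φ := by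
  have hint : Integrable (fun ω => (X ω - condMean X (channelOutput X N φ) P ω) ^ 2) P :=
    (hX2.sub (hX2.condExp one_le_two)).integrable_sq
  have hmmse : (∫ ω, bregmanDiv (fun x : ℝ => φ * x ^ 2) (X ω)
      (condMean X (channelOutput X N φ) P ω) ∂P) = φ * mmse X (channelOutput X N φ) P := by
    simp_rw [bregmanDiv_const_mul_sq]
    rw [integral_const_mul, mmse]
  have hderiv := hasDerivAt_mutualInfo_channelOutput hX hN hX2 hNlaw hXN φ
  refine ⟨fun t => (mutualInfo_channelOutput_eq hX hN hX2 hNlaw hXN t).1,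
    isBregmanGenerator_const_mul_sq, ?_, hint, hmmse ▸ hderiv, hmmse, hderiv⟩
  simp_rw [bregmanDiv_const_mul_sq]
  exact hint.const_mul φ
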